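/- Let $p$ be a prime, $q=p^s$ with $s>1$, let $0<i<s$, $h=(q-p^i)/2$ (an integer) and $m=\gcd(i,s)$. Let $\beta\in\mathbb{F}_{q^2}$ be a primitive $(q+1)$-th root of unity, and let $\mathcal{C}_{(q,q+1,3,h)}$ be the BCH code over $\mathbb{F}_q$ of length $q+1$ and designed distance $3$, that is, the cyclic code of length $q+1$ over $\mathbb{F}_q$ (an ideal of $\mathbb{F}_q[x]/(x^{q+1}-1)$, with words identified with polynomials of degree at most $q$) generated by the least common multiple of the minimal polynomials of $\beta^{h}$ and $\beta^{h+1}$ over $\mathbb{F}_q$. Then the dual code $\mathcal{C}^{\perp}_{(q,q+1,3,h)}$, with respect to the standard inner product on $\mathbb{F}_q^{q+1}$, has dimension $4$ over $\mathbb{F}_q$ and minimum Hamming distance $q-p^m$, i.e. it has parameters $[q+1,4,q-p^m]$, and it is a four-weight code: its nonzero codewords take exactly four distinct Hamming weights. -/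

import Mathlib

open Polynomial

namespace CodingTheory

/-- The polynomial `c₀ + c₁ x + ⋯ + c_{n-1} x^{n-1}` attached to a word `c` of length `n`. -/
noncomputable def wordPoly (F : Type*) [Field F] (n : ℕ) : (Fin n → F) →ₗ[F] F[X] where
  toFun c := ∑ j : Fin n, C (c j) * X ^ (j : ℕ)
  map_add' a b := by simp [add_mul, Finset.sum_add_distrib]
  map_smul' r a := by simp [Finset.mul_sum, mul_assoc, smul_eq_C_mul]

/-- The cyclic code of length `n` over `F` generated by `g`: the words whose polynomial lies,
modulo `x ^ n - 1`, in the ideal of `F[x] / (x ^ n - 1)` generated by the class of `g`. -/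
noncomputable def cyclicCode {F : Type*} [Field F] (n : ℕ) (g : F[X]) :
    Submodule F (Fin n → F) :=
  let I : Ideal F[X] := Ideal.span {X ^ n - 1}
  ((Ideal.span {Ideal.Quotient.mk I g} : Ideal (F[X] ⧸ I)).restrictScalars F).comap
    ((Ideal.Quotient.mkₐ F I).toLinearMap ∘ₗ wordPoly F n)

/-- The generator polynomial of a BCH code with designed distance `δ` and offset `h`: the least
common multiple over `F` of the minimal polynomials over `F` of
`β ^ h, β ^ (h + 1), …, β ^ (h + δ - 2)`. -/
noncomputable def bchPoly (F : Type*) [Field F] [DecidableEq F] {L : Type*} [Field L]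
    [Algebra F L] (β : L) (δ h : ℕ) : F[X] :=
  (Finset.range (δ - 1)).lcm fun j => minpoly F (β ^ (h + j))

/-- The BCH code over `F` of length `n`, designed distance `δ` and offset `h`, with respect to
the primitive `n`-th root of unity `β` in an extension field of `F`. -/
noncomputable def bchCode (F : Type*) [Field F] [DecidableEq F] {L : Type*} [Field L]
    [Algebra F L] (β : L) (n δ h : ℕ) : Submodule F (Fin n → F) :=
  cyclicCode n (bchPoly F β δ h)

/-- The dual code with respect to the standard inner product. -/
def dualCode {F : Type*} [Field F] {n : ℕ} (C : Submodule F (Fin n → F)) :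
    Submodule F (Fin n → F) where
  carrier := {v | ∀ c ∈ C, c ⬝ᵥ v = 0}
  add_mem' ha hb c hc := by simp [dotProduct_add, ha c hc, hb c hc]
  zero_mem' c _ := by simp
  smul_mem' r a ha c hc := by simp [dotProduct_smul, ha c hc]

/-- The number `A_w` of codewords of Hamming weight `w`. -/
noncomputable def weightCount {F : Type*} [Field F] [DecidableEq F] {n : ℕ}
    (C : Submodule F (Fin n → F)) (w : ℕ) : ℕ :=
  {c : Fin n → F | c ∈ C ∧ hammingNorm c = w}.ncard

/-- A code of length `n` is a `t`-weight code if exactly `t` of the numbers `A_1, …, A_n`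
are nonzero. -/
def IsWeightCode {F : Type*} [Field F] [DecidableEq F] {n : ℕ} (t : ℕ)
    (C : Submodule F (Fin n → F)) : Prop :=
  {w ∈ Finset.Icc 1 n | weightCount C w ≠ 0}.card = t

/-- `d` is the minimum distance of `C`, the least weight of a nonzero codeword. -/
def IsMinDist {F : Type*} [Field F] [DecidableEq F] {n : ℕ}
    (C : Submodule F (Fin n → F)) (d : ℕ) : Prop :=
  IsLeast {w : ℕ | ∃ c ∈ C, c ≠ 0 ∧ hammingNorm c = w} d

/-- `C`, a code of length `n`, has parameters `[n, k, d]`. -/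
def HasParameters {F : Type*} [Field F] [DecidableEq F] {n : ℕ}
    (C : Submodule F (Fin n → F)) (k d : ℕ) : Prop :=
  Module.finrank F C = k ∧ IsMinDist C d

end CodingTheory

/-! Write Q = p^i and let σ be the Frobenius power t ↦ t^Q on F. By Delsarte duality the dual words
are j ↦ ψ(x^h, x^(h+1)), with x = β^j and ψ an F-linear functional on L × L. Choose u with u^(q-1) =
x. Since x^q = x⁻¹ and 2h = q - Q, x^h is an F-multiple of u^(Q+1), so the entry at j vanishes iff
B(u, u) = 0, where B(u, v) = ψ(u^Q v, u^Q v^q) is σ-sesquilinear on the plane L. The u's represent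
each point of the projective line of L once, so zeros of a word are isotropic points of B. If B ≠ 0
has three isotropic points, scale them to e₁, e₂, e₁ + e₂. Then B(te₁ + e₂, te₁ + e₂) = (σ t - t)
B(e₁, e₂), giving 1 + |Fix σ| = 1 + p^m points (`card_isotropic`, `card_fixed_iterateFrobenius`).
Hence a nonzero ψ gives 0, 1, 2 or p^m + 1 zeros, fewer than q + 1, so the dimension is that of the
dual of L × L. All four counts occur because the Gram matrix of B is arbitrary
(`exists_powForm_eq`). -/

namespace CodingTheory

/-! ### Delsarte duality for the BCH code. -/

section BCH

variable {F : Type*} [Field F] {L : Type*} [Field L] [Algebra F L]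

lemma aeval_wordPoly {n : ℕ} (x : L) (c : Fin n → F) :
    aeval x (wordPoly F n c) = ∑ j, c j • x ^ (j : ℕ) := by
  simp [wordPoly, Algebra.smul_def]

lemma mem_cyclicCode_iff {n : ℕ} {g : F[X]} (hg : g ∣ X ^ n - 1) (c : Fin n → F) :
    c ∈ cyclicCode n g ↔ g ∣ wordPoly F n c := by
  simp only [cyclicCode, Submodule.mem_comap, Submodule.restrictScalars_mem,
    LinearMap.comp_apply, AlgHom.toLinearMap_apply, Ideal.Quotient.mkₐ_eq_mk,
    Ideal.mem_span_singleton]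
  constructor
  · rintro ⟨r, hr⟩
    obtain ⟨r, rfl⟩ := Ideal.Quotient.mk_surjective r
    rw [← map_mul, Ideal.Quotient.eq, Ideal.mem_span_singleton] at hr
    exact (dvd_iff_dvd_of_dvd_sub (hg.trans hr)).2 (dvd_mul_right g r)
  · exact map_dvd _

lemma mem_bchCode_iff [DecidableEq F] {β : L} {n δ h : ℕ} (hβ : β ^ n = 1) (c : Fin n → F) :
    c ∈ bchCode F β n δ h ↔
      ∀ k ∈ Finset.range (δ - 1), ∑ j, c j • (β ^ (h + k)) ^ (j : ℕ) = 0 := by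
  have hroot (k : ℕ) : aeval (β ^ (h + k)) (X ^ n - 1 : F[X]) = 0 := by
    simp [pow_right_comm β _ n, hβ]
  rw [bchCode, mem_cyclicCode_iff, bchPoly, Finset.lcm_dvd_iff]
  · simp only [← aeval_wordPoly]
    exact forall₂_congr fun k _ => minpoly.dvd_iff
  · exact Finset.lcm_dvd fun k _ => minpoly.dvd F _ (hroot k)

/-- Delsarte's description of the dual code of a BCH code: its words are the values of linear
functionals at the vectors of powers of the roots. -/
lemma mem_dualCode_bchCode_iff [DecidableEq F] {β : L} {n h : ℕ} (hβ : β ^ n = 1) (v : Fin n → F) :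
    v ∈ dualCode (bchCode F β n 3 h) ↔ ∃ ψ : Module.Dual F (L × L),
      v = fun j : Fin n => ψ ((β ^ (j : ℕ)) ^ h, (β ^ (j : ℕ)) ^ (h + 1)) := by
  let x : Fin n → L × L := fun j => ((β ^ (j : ℕ)) ^ h, (β ^ (j : ℕ)) ^ (h + 1))
  have hmem (c : Fin n → F) : c ∈ bchCode F β n 3 h ↔ Fintype.linearCombination F x c = 0 := by
    rw [mem_bchCode_iff hβ]
    simp only [Finset.mem_range, Fintype.linearCombination_apply, Prod.ext_iff, Prod.fst_sum,
      Prod.snd_sum, x, Prod.smul_fst, Prod.smul_snd, Prod.fst_zero, Prod.snd_zero]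
    constructor
    · intro H
      have h0 := H 0 (by norm_num)
      have h1 := H 1 (by norm_num)
      simp only [pow_right_comm β _ h, pow_right_comm β _ (h + 1)]
      exact ⟨h0, h1⟩
    · rintro ⟨h0, h1⟩ k hk
      simp only [pow_right_comm β _ h, pow_right_comm β _ (h + 1)] at h0 h1
      interval_cases k
      · exact h0
      · exact h1
  constructor
  · intro hv
    -- A functional vanishing on the kernel of c ↦ ∑ c_j x_j factors through that map; the factor is
    -- ψ.
    have hann : (Fintype.linearCombination F v : (Fin n → F) →ₗ[F] F) ∈
        (LinearMap.ker (Fintype.linearCombination F x)).dualAnnihilator := by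
      rw [Submodule.mem_dualAnnihilator]
      intro c hc
      have := hv c ((hmem c).2 hc)
      simpa [Fintype.linearCombination_apply, dotProduct] using this
    rw [← LinearMap.range_dualMap_eq_dualAnnihilator_ker] at hann
    obtain ⟨ψ, hψ⟩ := hann
    refine ⟨ψ, funext fun j => ?_⟩
    have := LinearMap.congr_fun hψ (Pi.single j 1)
    simpa [Fintype.linearCombination_apply_single, x] using this.symm
  · rintro ⟨ψ, rfl⟩ c hc
    have := congrArg ψ ((hmem c).1 hc)
    simp only [Fintype.linearCombination_apply, map_sum, map_smul, map_zero, smul_eq_mul] at this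
    exact this

end BCH

/-! ### Isotropic points of sesquilinear forms on a plane. -/

section Forms

variable {F : Type*} [Field F] {V : Type*} [AddCommGroup V] [Module F V] {σ : F →+* F}

/-- Counting the points of a projective line in coordinates. -/
lemma card_projective_line [Fintype F] {ι : Type*} [Fintype ι] {u : ι → V}
    (hι : Fintype.card ι = Fintype.card F + 1)
    (hu : ∀ v : V, v ≠ 0 → ∃ j, ∃ c : F, c ≠ 0 ∧ v = c • u j) {e₁ e₂ : V}
    (he : LinearIndependent F ![e₁, e₂]) (P : V → Prop) [DecidablePred P]
    (hP : ∀ c : F, c ≠ 0 → ∀ v, P (c • v) ↔ P v) :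
    Fintype.card {j // P (u j)} =
      (if P e₁ then 1 else 0) + Fintype.card {t : F // P (t • e₁ + e₂)} := by
  -- Here `none` is the point at infinity.
  let w : Option F → V := fun o => o.elim e₁ fun t => t • e₁ + e₂
  rw [LinearIndependent.pair_iff] at he
  have hw (o : Option F) : w o ≠ 0 := by
    cases o with
    | none => intro H; simpa using he 1 0 (by simpa [w] using H)
    | some t => intro H; simpa using he t 1 (by simpa [w] using H)
  choose f c hc hf using fun o => hu (w o) (hw o)
  have hinj : Function.Injective f := by
    intro a b hab
    have hrel : c b • w a - c a • w b = 0 := by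
      rw [hf a, hf b, hab, smul_smul, smul_smul, mul_comm, sub_self]
    cases a with
    | none => cases b with
      | none => rfl
      | some t =>
        have := he (c (some t) - c none * t) (-c none) (by
          rw [← hrel]; simp only [w, Option.elim]; module)
        exact absurd (neg_eq_zero.1 this.2) (hc _)
    | some t => cases b with
      | none =>
        have := he (c none * t - c (some t)) (c none) (by
          rw [← hrel]; simp only [w, Option.elim]; module)
        exact absurd this.2 (hc _)
      | some t' =>
        have := he (c (some t') * t - c (some t) * t') (c (some t') - c (some t)) (by
          rw [← hrel]; simp only [w, Option.elim]; module)
        have h2 := sub_eq_zero.1 this.2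
        have h1 := this.1
        rw [h2, ← mul_sub] at h1
        rw [sub_eq_zero.1 ((mul_eq_zero.1 h1).resolve_left (hc _))]
  have hbij : Function.Bijective f := by
    rw [Fintype.bijective_iff_injective_and_card]
    exact ⟨hinj, by simp [hι]⟩
  have hPf (o : Option F) : P (w o) ↔ P (u (f o)) := by
    conv_lhs => rw [hf o]
    exact hP _ (hc o) _
  rw [← Fintype.card_congr ((Equiv.ofBijective f hbij).subtypeEquiv hPf)]
  simp only [Fintype.card_subtype, Finset.card_filter, Fintype.sum_option]
  rfl

variable (B : V →ₛₗ[σ] V →ₗ[F] F)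

lemma form_smul_self_eq_zero_iff {c : F} (hc : c ≠ 0) (v : V) :
    B (c • v) (c • v) = 0 ↔ B v v = 0 := by
  simp [hc]

lemma form_apply_coords (e₁ e₂ : V) (t : F) :
    B (t • e₁ + e₂) (t • e₁ + e₂) =
      σ t * t * B e₁ e₁ + σ t * B e₁ e₂ + t * B e₂ e₁ + B e₂ e₂ := by
  simp
  ring

lemma exists_coords (hV : Module.finrank F V = 2) {e₁ e₂ : V}
    (he : LinearIndependent F ![e₁, e₂]) (v : V) : ∃ a b : F, v = a • e₁ + b • e₂ := by
  have := he.span_eq_top_of_card_eq_finrank (by simp [hV])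
  have hv : v ∈ Submodule.span F (Set.range ![e₁, e₂]) := this ▸ Submodule.mem_top
  rw [Matrix.range_cons_cons_empty, Submodule.mem_span_pair] at hv
  obtain ⟨a, b, h⟩ := hv
  exact ⟨a, b, h.symm⟩

/-- A nonzero `σ`-sesquilinear form on a plane has at most two isotropic lines, or as many as
there are points on the projective line over the fixed field of `σ`. -/
lemma card_isotropic [Fintype F] [DecidableEq F] {ι : Type*} [Fintype ι] {u : ι → V}
    (hV : Module.finrank F V = 2)
    (hι : Fintype.card ι = Fintype.card F + 1)
    (hu : ∀ v : V, v ≠ 0 → ∃ j, ∃ c : F, c ≠ 0 ∧ v = c • u j)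
    (hind : ∀ a b, a ≠ b → LinearIndependent F ![u a, u b]) (hB : B ≠ 0) :
    Fintype.card {j // B (u j) (u j) = 0} ≤ 2 ∨
      Fintype.card {j // B (u j) (u j) = 0} = 1 + Fintype.card {t : F // σ t = t} := by
  classical
  rw [or_iff_not_imp_left, not_le, Fintype.card_subtype, Finset.two_lt_card]
  rintro ⟨j₁, h₁, j₂, h₂, j₃, h₃, h₁₂, h₁₃, h₂₃⟩
  rw [← Fintype.card_subtype]
  simp only [Finset.mem_filter_univ] at h₁ h₂ h₃
  obtain ⟨a, b, hab⟩ := exists_coords hV (hind _ _ h₁₂) (u j₃)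
  have ha : a ≠ 0 := by
    rintro rfl
    have := (LinearIndependent.pair_iff.1 (hind _ _ h₂₃)) b (-1) (by rw [hab]; module)
    simp at this
  have hb : b ≠ 0 := by
    rintro rfl
    have := (LinearIndependent.pair_iff.1 (hind _ _ h₁₃)) a (-1) (by rw [hab]; module)
    simp at this
  -- Rescaling the first two isotropic vectors makes the third their sum.
  have he : LinearIndependent F ![a • u j₁, b • u j₂] := by
    rw [LinearIndependent.pair_iff]
    intro s t hst
    have := (LinearIndependent.pair_iff.1 (hind _ _ h₁₂)) (s * a) (t * b) (by
      rw [← hst]; module)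
    simpa [ha, hb] using this
  have h11 : B (a • u j₁) (a • u j₁) = 0 := (form_smul_self_eq_zero_iff B ha _).2 h₁
  have h22 : B (b • u j₂) (b • u j₂) = 0 := (form_smul_self_eq_zero_iff B hb _).2 h₂
  rw [hab] at h₃
  generalize a • u j₁ = e₁ at *
  generalize b • u j₂ = e₂ at *
  have h21 : B e₂ e₁ = -B e₁ e₂ := by
    simp only [map_add, LinearMap.add_apply, h11, h22, zero_add, add_zero] at h₃
    exact eq_neg_of_add_eq_zero_left h₃
  have h12 : B e₁ e₂ ≠ 0 := by
    intro h
    refine hB (LinearMap.ext fun v => LinearMap.ext fun w => ?_)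
    obtain ⟨x, y, rfl⟩ := exists_coords hV he v
    obtain ⟨z, t, rfl⟩ := exists_coords hV he w
    simp [h11, h22, h21, h]
  rw [card_projective_line hι hu he (fun v => B v v = 0)
    (fun c hc v => form_smul_self_eq_zero_iff B hc v), if_pos h11]
  congr 1
  refine Fintype.card_congr (Equiv.subtypeEquivRight fun t => ?_)
  rw [form_apply_coords, h11, h22, h21]
  rw [show σ t * t * 0 + σ t * B e₁ e₂ + t * -B e₁ e₂ + 0 = (σ t - t) * B e₁ e₂ by ring,
    mul_eq_zero, or_iff_left h12, sub_eq_zero]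

end Forms
-- Subfields and fixed points of Frobenius.
section FiniteField

variable {F : Type*} [Field F] [Fintype F]

/-- X^q - X already splits over F, so it gains no roots in L. -/
lemma exists_algebraMap_eq_of_pow_card {L : Type*} [Field L]
    [Algebra F L] {x : L} (hx : x ^ Fintype.card F = x) : ∃ c : F, algebraMap F L c = x := by
  have hne : (X ^ Fintype.card F - X : F[X]) ≠ 0 :=
    FiniteField.X_pow_card_sub_X_ne_zero F Fintype.one_lt_card
  have hs : (X ^ Fintype.card F - X : F[X]).Splits := by
    rw [splits_iff_card_roots, FiniteField.roots_X_pow_card_sub_X, ← Finset.card_def,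
      Finset.card_univ, FiniteField.X_pow_card_sub_X_natDegree_eq F Fintype.one_lt_card]
  have := hs.mem_range_of_isRoot (i := algebraMap F L) hne (x := x) (by simp [hx])
  exact this

lemma exists_smul_eq_of_pow_eq_one {L : Type*} [Field L] [Algebra F L] {x : L}
    (hx : x ^ (Fintype.card F - 1) = 1) : ∃ c : F, c ≠ 0 ∧ algebraMap F L c = x := by
  have hq := Fintype.card_pos (α := F)
  obtain ⟨c, rfl⟩ := exists_algebraMap_eq_of_pow_card (F := F) (x := x) (by
    rw [← Nat.sub_add_cancel hq, pow_succ, hx, one_mul])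
  refine ⟨c, ?_, rfl⟩
  rintro rfl
  have : Fintype.card F - 1 ≠ 0 := by have := Fintype.one_lt_card (α := F); omega
  simp [this] at hx

/-- The nonzero fixed points are the (p^i - 1)-torsion of a cyclic group of order p^s - 1, so they
number gcd(p^i - 1, p^s - 1) = p^gcd(i, s) - 1; zero adds one. -/
lemma card_fixed_iterateFrobenius [DecidableEq F] {p s i : ℕ}
    [ExpChar F p] (hp : 1 < p) (hi : 0 < i) (hF : Fintype.card F = p ^ s) :
    Fintype.card {t : F // iterateFrobenius F p i t = t} = p ^ Nat.gcd i s := by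
  have hker := IsCyclic.card_powMonoidHom_ker Fˣ (p ^ i - 1)
  rw [Nat.card_units, Nat.card_eq_fintype_card (α := F), hF, Nat.pow_sub_one_gcd_pow_sub_one,
    Nat.gcd_comm] at hker
  have hpi := Nat.one_lt_pow hi.ne' hp
  have hfix (x : Fˣ) : x ∈ (powMonoidHom (p ^ i - 1) : Fˣ →* Fˣ).ker ↔
      iterateFrobenius F p i (x : F) = x := by
    rw [MonoidHom.mem_ker, powMonoidHom_apply, iterateFrobenius_def, Units.ext_iff]
    nth_rw 2 [← Nat.sub_add_cancel hpi.le]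
    simp [pow_succ]
  have hcard : Fintype.card {t : F // iterateFrobenius F p i t = t} =
      Nat.card (Option (powMonoidHom (p ^ i - 1) : Fˣ →* Fˣ).ker) := by
    rw [Fintype.card_eq_nat_card]
    refine (Nat.card_eq_of_bijective (fun o => o.elim ⟨0, by simp⟩
      fun x => ⟨((x : Fˣ) : F), (hfix x).1 x.2⟩) ⟨?_, ?_⟩).symm
    · rintro (_ | x) (_ | y) h
      · rfl
      · exact absurd (congrArg Subtype.val h).symm y.1.ne_zero
      · exact absurd (congrArg Subtype.val h) x.1.ne_zero
      · exact congrArg some (Subtype.ext (Units.ext (congrArg Subtype.val h)))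
    · rintro ⟨t, ht⟩
      by_cases h0 : t = 0
      · exact ⟨none, by simp [h0]⟩
      · exact ⟨some ⟨Units.mk0 t h0, (hfix _).2 ht⟩, rfl⟩
  rw [hcard, Finite.card_option, hker]
  exact Nat.sub_add_cancel (Nat.one_le_pow _ _ (by omega))

end FiniteField

/-! ### The form of a functional and its Gram matrix. -/

section PowForm

variable {F : Type*} [Field F] [Fintype F] {L : Type*} [Field L] [Algebra F L]
  (p i : ℕ) [ExpChar F p] [ExpChar L p]

/-- The form `(u, v) ↦ ψ (u ^ (p ^ i) * v, u ^ (p ^ i) * v ^ q)` attached to a functional `ψ`. -/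
noncomputable def powForm (ψ : Module.Dual F (L × L)) :
    L →ₛₗ[iterateFrobenius F p i] L →ₗ[F] F :=
  LinearMap.mk₂'ₛₗ _ _
    (fun u v => ψ (u ^ p ^ i * v, u ^ p ^ i * FiniteField.frobeniusAlgHom F L v))
    (fun u₁ u₂ v => by
      simp only [add_pow_expChar_pow, add_mul, ← map_add, Prod.mk_add_mk])
    (fun c u v => by
      simp only [iterateFrobenius_def, _root_.smul_pow, smul_mul_assoc, ← map_smul, ← Prod.smul_mk])
    (fun u v₁ v₂ => by simp only [mul_add, ← Prod.mk_add_mk, map_add])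
    (fun c u v => by
      simp only [map_smul, mul_smul_comm, ← Prod.smul_mk, RingHom.id_apply])

lemma powForm_apply (ψ : Module.Dual F (L × L)) (u v : L) :
    powForm p i ψ u v = ψ (u ^ p ^ i * v, u ^ p ^ i * v ^ Fintype.card F) := rfl

/-- As u ↦ u^(p^i) is onto, ψ kills every (wv, wv^q); taking v = 1 and v = θ these already span L ×
L. -/
lemma eq_zero_of_powForm_eq_zero [Finite L] {θ : L} (hθ : θ ^ Fintype.card F ≠ θ)
    {ψ : Module.Dual F (L × L)} (h : powForm p i ψ = 0) : ψ = 0 := by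
  have key (w v : L) : ψ (w * v, w * v ^ Fintype.card F) = 0 := by
    obtain ⟨u, rfl⟩ := (bijective_iterateFrobenius L p i).2 w
    rw [iterateFrobenius_def, ← powForm_apply, h]
    rfl
  refine LinearMap.ext fun ⟨a, b⟩ => ?_
  have hd := sub_ne_zero.2 hθ
  set w := (b - a) / (θ ^ Fintype.card F - θ) with hw
  have hab : ((a, b) : L × L) = ((a - w * θ) * 1, (a - w * θ) * 1 ^ Fintype.card F) +
      (w * θ, w * θ ^ Fintype.card F) := by
    ext
    · simp
    · have : w * (θ ^ Fintype.card F - θ) = b - a := div_mul_cancel₀ _ hd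
      simp only [one_pow, Prod.mk_add_mk]
      linear_combination -this
  rw [hab, map_add, key, key, add_zero, LinearMap.zero_apply]

/-- The Gram matrix of `powForm p i ψ` in a given basis can be prescribed. -/
lemma exists_powForm_eq [FiniteDimensional F L] (hL : Module.finrank F L = 2) {θ : L}
    (hθ : θ ^ Fintype.card F ≠ θ) {e₁ e₂ : L} (he : LinearIndependent F ![e₁, e₂])
    (a b c d : F) : ∃ ψ : Module.Dual F (L × L), powForm p i ψ e₁ e₁ = a ∧
      powForm p i ψ e₁ e₂ = b ∧ powForm p i ψ e₂ e₁ = c ∧ powForm p i ψ e₂ e₂ = d := by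
  have : Finite L := Module.finite_of_finite F
  let w (k : Fin 2 × Fin 2) : L × L :=
    ((![e₁, e₂] k.1) ^ p ^ i * ![e₁, e₂] k.2,
      (![e₁, e₂] k.1) ^ p ^ i * (![e₁, e₂] k.2) ^ Fintype.card F)
  let Φ : Module.Dual F (L × L) →ₗ[F] (Fin 2 × Fin 2 → F) :=
    LinearMap.pi fun k => Module.Dual.eval F (L × L) (w k)
  have hinj : Function.Injective Φ := by
    rw [injective_iff_map_eq_zero]
    intro ψ hψ
    have hk (k l : Fin 2) : powForm p i ψ (![e₁, e₂] k) (![e₁, e₂] l) = 0 := congrFun hψ (k, l)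
    refine eq_zero_of_powForm_eq_zero p i hθ (LinearMap.ext fun u => LinearMap.ext fun v => ?_)
    obtain ⟨x, y, rfl⟩ := exists_coords hL he u
    obtain ⟨z, t, rfl⟩ := exists_coords hL he v
    have h00 : powForm p i ψ e₁ e₁ = 0 := hk 0 0
    have h01 : powForm p i ψ e₁ e₂ = 0 := hk 0 1
    have h10 : powForm p i ψ e₂ e₁ = 0 := hk 1 0
    have h11 : powForm p i ψ e₂ e₂ = 0 := hk 1 1
    simp [h00, h01, h10, h11]
  -- Both sides have dimension 4.
  have hsurj := (LinearMap.injective_iff_surjective_of_finrank_eq_finrank (by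
    simp [Subspace.dual_finrank_eq, Module.finrank_prod, hL])).1 hinj
  obtain ⟨ψ, hψ⟩ := hsurj fun k => ![![a, b], ![c, d]] k.1 k.2
  exact ⟨ψ, congrFun hψ (0, 0), congrFun hψ (0, 1), congrFun hψ (1, 0), congrFun hψ (1, 1)⟩

end PowForm
-- Roots of unity as points of the projective line.
section Points

variable {F : Type*} [Field F] [Fintype F] {L : Type*} [Field L] [Algebra F L]

lemma pow_card_sub_one_pow_card_add_one [FiniteDimensional F L] (hL : Module.finrank F L = 2)
    {v : L} (hv : v ≠ 0) : (v ^ (Fintype.card F - 1)) ^ (Fintype.card F + 1) = 1 := by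
  have : Finite L := Module.finite_of_finite F
  have := Fintype.ofFinite L
  have hq := Fintype.card_pos (α := F)
  have h := FiniteField.pow_card_sub_one_eq_one v hv
  rw [Module.card_eq_pow_finrank (K := F), hL] at h
  rw [← pow_mul, ← h, mul_comm, ← Nat.sq_sub_sq, one_pow]

/-- Hilbert 90 for L/F, read off from the cyclic group Lˣ of order (q - 1)(q + 1). -/
lemma exists_pow_card_sub_one_eq [FiniteDimensional F L] (hL : Module.finrank F L = 2)
    {x : L} (hx : x ^ (Fintype.card F + 1) = 1) :
    ∃ u : L, u ≠ 0 ∧ u ^ (Fintype.card F - 1) = x := by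
  have : Finite L := Module.finite_of_finite F
  have := Fintype.ofFinite L
  have hq := Fintype.one_lt_card (α := F)
  have hx0 : x ≠ 0 := by
    rintro rfl
    simp at hx
  have hcard : Nat.card Lˣ = (Fintype.card F - 1) * (Fintype.card F + 1) := by
    rw [Nat.card_units, Nat.card_eq_fintype_card, Module.card_eq_pow_finrank (K := F), hL,
      mul_comm, ← Nat.sq_sub_sq, one_pow]
  obtain ⟨g, hg⟩ := IsCyclic.exists_generator (α := Lˣ)
  obtain ⟨k, hk⟩ := mem_powers_iff_mem_zpowers.2 (hg (Units.mk0 x hx0))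
  have hk' : g ^ k = Units.mk0 x hx0 := hk
  have hdvd : orderOf g ∣ k * (Fintype.card F + 1) := by
    apply orderOf_dvd_of_pow_eq_one
    rw [pow_mul, hk', Units.ext_iff]
    simpa using hx
  rw [orderOf_eq_card_of_forall_mem_zpowers hg, hcard] at hdvd
  obtain ⟨l, rfl⟩ := Nat.dvd_of_mul_dvd_mul_right (Nat.succ_pos _) hdvd
  refine ⟨((g ^ l : Lˣ) : L), Units.ne_zero _, ?_⟩
  rw [← Units.val_pow_eq_pow_val, ← pow_mul, mul_comm, hk', Units.val_mk0]

lemma exists_pow_card_sub_one_eq_pow [FiniteDimensional F L] (hL : Module.finrank F L = 2)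
    {β : L} (hβ : IsPrimitiveRoot β (Fintype.card F + 1)) :
    ∃ u : ℕ → L, (∀ j, u j ≠ 0) ∧ ∀ j, u j ^ (Fintype.card F - 1) = β ^ j := by
  obtain ⟨γ, hγ0, rfl⟩ := exists_pow_card_sub_one_eq hL hβ.pow_eq_one
  exact ⟨fun j => γ ^ j, fun j => pow_ne_zero j hγ0, fun j => pow_right_comm _ _ _⟩

lemma pow_card_ne_self_of_isPrimitiveRoot {K : Type*} [Field K] {β : K}
    (hβ : IsPrimitiveRoot β (Fintype.card F + 1)) : β ^ Fintype.card F ≠ β := by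
  intro h
  have h2 : β ^ 2 = 1 := by rw [← hβ.pow_eq_one, pow_succ β (Fintype.card F), h, sq]
  have := Nat.le_of_dvd (by norm_num) (hβ.dvd_of_pow_eq_one 2 h2)
  have := Fintype.one_lt_card (α := F)
  omega

lemma pairwise_linearIndependent_of_pow {u : ℕ → L} {β : L} {n : ℕ} (hβ : IsPrimitiveRoot β n)
    (hu0 : ∀ j, u j ≠ 0) (hu : ∀ j, u j ^ (Fintype.card F - 1) = β ^ j) (a b : Fin n)
    (hab : a ≠ b) : LinearIndependent F ![u a, u b] := by
  rw [LinearIndependent.pair_iff' (hu0 a)]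
  intro c hc
  have hc0 : c ≠ 0 := by
    rintro rfl
    exact hu0 b (by rw [← hc, zero_smul])
  apply hab
  have := congrArg (· ^ (Fintype.card F - 1)) hc
  simp only [_root_.smul_pow, FiniteField.pow_card_sub_one_eq_one c hc0, one_smul, hu] at this
  exact Fin.ext (hβ.pow_inj a.2 b.2 this)

lemma exists_eq_smul_of_pow [FiniteDimensional F L] (hL : Module.finrank F L = 2)
    {u : ℕ → L} {β : L} (hβ : IsPrimitiveRoot β (Fintype.card F + 1))
    (hu0 : ∀ j, u j ≠ 0) (hu : ∀ j, u j ^ (Fintype.card F - 1) = β ^ j) (v : L) (hv : v ≠ 0) :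
    ∃ j : Fin (Fintype.card F + 1), ∃ c : F, c ≠ 0 ∧ v = c • u j := by
  obtain ⟨j, hj, h⟩ := hβ.eq_pow_of_pow_eq_one (pow_card_sub_one_pow_card_add_one hL hv)
  obtain ⟨c, hc, hcv⟩ := exists_smul_eq_of_pow_eq_one (F := F) (x := v / u j) (by
    rw [div_pow, hu, h, div_self (pow_ne_zero _ hv)])
  exact ⟨⟨j, hj⟩, c, hc, by rw [Algebra.smul_def, hcv, div_mul_cancel₀ _ (hu0 j)]⟩

/-- Up to a scalar of `F`, the vector `(x ^ h, x ^ (h + 1))` at `x = u ^ (q - 1)` is the vector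
`(u ^ Q * u, u ^ Q * u ^ q)`, where `2 * h = q - Q`. -/
lemma exists_smul_eq_pow_prod {h Q : ℕ} (hh : 2 * h + Q = Fintype.card F) {u x : L} (hu0 : u ≠ 0)
    (hu : u ^ (Fintype.card F - 1) = x) (hx : x ^ (Fintype.card F + 1) = 1) :
    ∃ c : F, c ≠ 0 ∧ ((x ^ h, x ^ (h + 1)) : L × L) =
      c • (u ^ Q * u, u ^ Q * u ^ Fintype.card F) := by
  have hq := Fintype.card_pos (α := F)
  have hx0 : x ≠ 0 := hu ▸ pow_ne_zero _ hu0
  -- This is x^(-2h) = x^(Q+1), multiplied by x^(2h) to avoid negative exponents. It makes x^h /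
  -- u^(Q+1) a (q-1)-th root of unity, hence in F.
  have hxh : (x ^ h) ^ (Fintype.card F - 1) = x ^ (Q + 1) := by
    apply mul_right_cancel₀ (pow_ne_zero (2 * h) hx0)
    rw [← pow_mul, ← pow_add, ← pow_add, show Q + 1 + 2 * h = Fintype.card F + 1 by omega, hx]
    have : h * (Fintype.card F - 1) + 2 * h = (Fintype.card F + 1) * h := by
      rw [mul_comm h, ← add_mul]
      congr 1
      omega
    rw [this, pow_mul, hx, one_pow]
  obtain ⟨c, hc, hcx⟩ := exists_smul_eq_of_pow_eq_one (F := F) (x := x ^ h / u ^ (Q + 1)) (by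
    rw [div_pow, hxh, pow_right_comm, hu, div_self (pow_ne_zero _ hx0)])
  have h1 : x ^ h = c • (u ^ Q * u) := by
    rw [Algebra.smul_def, hcx, ← pow_succ, div_mul_cancel₀ _ (pow_ne_zero _ hu0)]
  refine ⟨c, hc, Prod.ext h1 ?_⟩
  change x ^ (h + 1) = c • (u ^ Q * u ^ Fintype.card F)
  rw [pow_succ, h1, smul_mul_assoc, ← hu, mul_assoc, mul_pow_sub_one hq.ne']

end Points

/-! ### Weights and zeros. -/

section Weights

variable {F : Type*} [Field F] [DecidableEq F] {n : ℕ}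

lemma weightCount_ne_zero_iff [Finite F] (C : Submodule F (Fin n → F)) (w : ℕ) :
    weightCount C w ≠ 0 ↔ ∃ c ∈ C, hammingNorm c = w := by
  rw [weightCount, Ne, Set.ncard_eq_zero (Set.toFinite _), ← Ne, ← Set.nonempty_iff_ne_empty]
  rfl

lemma hammingNorm_add_card_zeros (c : Fin n → F) :
    hammingNorm c + Fintype.card {j // c j = 0} = n := by
  rw [hammingNorm, Fintype.card_subtype, add_comm]
  simpa using Finset.card_filter_add_card_filter_not (s := Finset.univ) fun j => c j = 0

end Weights

/-! ### Zero counts and dimension of the dual code. -/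

section Main

variable {F : Type*} [Field F] [Fintype F] [DecidableEq F] {L : Type*} [Field L] [Algebra F L]
  {p i h : ℕ} [ExpChar F p] [ExpChar L p] {β : L}

/-- The codeword attached to a functional has as many zeros as its form has isotropic points. -/
lemma card_zeros_eq (hh : 2 * h + p ^ i = Fintype.card F)
    (hβ : IsPrimitiveRoot β (Fintype.card F + 1)) {u : ℕ → L} (hu0 : ∀ j, u j ≠ 0)
    (hu : ∀ j, u j ^ (Fintype.card F - 1) = β ^ j) (ψ : Module.Dual F (L × L)) :
    Fintype.card {j : Fin (Fintype.card F + 1) //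
        ψ ((β ^ (j : ℕ)) ^ h, (β ^ (j : ℕ)) ^ (h + 1)) = 0} =
      Fintype.card {j : Fin (Fintype.card F + 1) // powForm p i ψ (u j) (u j) = 0} := by
  refine Fintype.card_congr (Equiv.subtypeEquivRight fun j => ?_)
  obtain ⟨c, hc, hcx⟩ := exists_smul_eq_pow_prod hh (hu0 j) (hu j)
    (by rw [pow_right_comm, hβ.pow_eq_one, one_pow])
  rw [hcx, map_smul, smul_eq_zero, or_iff_right hc, powForm_apply]

/-- The possible numbers of zeros of a nonzero word. -/
lemma card_zeros_mem [FiniteDimensional F L] (hL : Module.finrank F L = 2)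
    (hh : 2 * h + p ^ i = Fintype.card F) (hβ : IsPrimitiveRoot β (Fintype.card F + 1))
    {ψ : Module.Dual F (L × L)} (hψ : ψ ≠ 0) :
    Fintype.card {j : Fin (Fintype.card F + 1) //
        ψ ((β ^ (j : ℕ)) ^ h, (β ^ (j : ℕ)) ^ (h + 1)) = 0} ∈
      ({0, 1, 2, 1 + Fintype.card {t : F // iterateFrobenius F p i t = t}} : Finset ℕ) := by
  have : Finite L := Module.finite_of_finite F
  obtain ⟨u, hu0, hu⟩ := exists_pow_card_sub_one_eq_pow hL hβ
  have hB : powForm p i ψ ≠ 0 := fun H =>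
    hψ (eq_zero_of_powForm_eq_zero p i (pow_card_ne_self_of_isPrimitiveRoot hβ) H)
  rw [card_zeros_eq hh hβ hu0 hu]
  rcases card_isotropic (u := fun j : Fin (Fintype.card F + 1) => u j) _ hL
    (Fintype.card_fin _) (exists_eq_smul_of_pow hL hβ hu0 hu)
    (pairwise_linearIndependent_of_pow hβ hu0 hu) hB with H | H
  · simp only [Finset.mem_insert]
    omega
  · simp [H]

lemma exists_card_zeros_eq_coords [FiniteDimensional F L] (hL : Module.finrank F L = 2)
    (hh : 2 * h + p ^ i = Fintype.card F) (hβ : IsPrimitiveRoot β (Fintype.card F + 1))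
    (a b c d : F) :
    ∃ ψ : Module.Dual F (L × L), Fintype.card {j : Fin (Fintype.card F + 1) //
        ψ ((β ^ (j : ℕ)) ^ h, (β ^ (j : ℕ)) ^ (h + 1)) = 0} =
      (if a = 0 then 1 else 0) + Fintype.card {t : F // iterateFrobenius F p i t * t * a +
        iterateFrobenius F p i t * b + t * c + d = 0} := by
  obtain ⟨u, hu0, hu⟩ := exists_pow_card_sub_one_eq_pow hL hβ
  have hq := Fintype.card_pos (α := F)
  have he := pairwise_linearIndependent_of_pow hβ hu0 hu ⟨0, by omega⟩ ⟨1, by omega⟩ (by simp)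
  obtain ⟨ψ, h11, h12, h21, h22⟩ :=
    exists_powForm_eq p i hL (pow_card_ne_self_of_isPrimitiveRoot hβ) he a b c d
  refine ⟨ψ, ?_⟩
  rw [card_zeros_eq hh hβ hu0 hu, card_projective_line
    (u := fun j : Fin (Fintype.card F + 1) => u j) (Fintype.card_fin _)
    (exists_eq_smul_of_pow hL hβ hu0 hu) he (fun v => powForm p i ψ v v = 0)
    (fun c hc v => form_smul_self_eq_zero_iff _ hc v)]
  simp only [form_apply_coords, h11, h12, h21, h22]


/-- All these numbers of zeros occur. -/
lemma exists_card_zeros_eq [FiniteDimensional F L] (hL : Module.finrank F L = 2)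
    (hh : 2 * h + p ^ i = Fintype.card F) (hβ : IsPrimitiveRoot β (Fintype.card F + 1))
    {k : ℕ} (hk : k ∈
      ({0, 1, 2, 1 + Fintype.card {t : F // iterateFrobenius F p i t = t}} : Finset ℕ)) :
    ∃ ψ : Module.Dual F (L × L), Fintype.card {j : Fin (Fintype.card F + 1) //
        ψ ((β ^ (j : ℕ)) ^ h, (β ^ (j : ℕ)) ^ (h + 1)) = 0} = k := by
  have hcoords := exists_card_zeros_eq_coords (p := p) (i := i) (h := h) hL hh hβ
  have hzero (t : F) : iterateFrobenius F p i t = 0 ↔ t = 0 :=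
    map_eq_zero_iff _ (iterateFrobenius F p i).injective
  simp only [Finset.mem_insert, Finset.mem_singleton] at hk
  rcases hk with rfl | rfl | rfl | rfl
  · have hns : ¬ Function.Surjective fun t : F => iterateFrobenius F p i t * t - t := by
      rw [← Finite.injective_iff_surjective]
      intro H
      exact zero_ne_one (H (a₁ := 0) (a₂ := 1) (by simp))
    obtain ⟨d, hd⟩ := not_forall.1 hns
    obtain ⟨ψ, hψ⟩ := hcoords 1 0 (-1) (-d)
    refine ⟨ψ, hψ.trans ?_⟩
    rw [if_neg one_ne_zero, zero_add, Fintype.card_eq_zero_iff]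
    refine ⟨fun ⟨t, ht⟩ => hd ⟨t, ?_⟩⟩
    change iterateFrobenius F p i t * t - t = d
    linear_combination ht
  · obtain ⟨ψ, hψ⟩ := hcoords 1 0 0 0
    exact ⟨ψ, hψ.trans (by simp [hzero])⟩
  -- With a = 0 the point e₁ is isotropic; t = 0 gives the second one.
  · obtain ⟨ψ, hψ⟩ := hcoords 0 1 0 0
    exact ⟨ψ, hψ.trans (by simp [hzero])⟩
  · obtain ⟨ψ, hψ⟩ := hcoords 0 1 (-1) 0
    refine ⟨ψ, hψ.trans ?_⟩
    simp [← sub_eq_add_neg, sub_eq_zero]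

/-- The dual code is parametrised linearly and injectively by functionals on `L × L`. -/
lemma finrank_dualCode_bchCode [FiniteDimensional F L] (hL : Module.finrank F L = 2)
    (hβ : IsPrimitiveRoot β (Fintype.card F + 1))
    (hne : ∀ ψ : Module.Dual F (L × L), ψ ≠ 0 → ∃ j : Fin (Fintype.card F + 1),
      ψ ((β ^ (j : ℕ)) ^ h, (β ^ (j : ℕ)) ^ (h + 1)) ≠ 0) :
    Module.finrank F (dualCode (bchCode F β (Fintype.card F + 1) 3 h)) = 4 := by
  let T : Module.Dual F (L × L) →ₗ[F] (Fin (Fintype.card F + 1) → F) :=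
    LinearMap.pi fun j => Module.Dual.eval F (L × L)
      ((β ^ (j : ℕ)) ^ h, (β ^ (j : ℕ)) ^ (h + 1))
  have hT : Function.Injective T := by
    rw [injective_iff_map_eq_zero]
    intro ψ hψ
    by_contra h0
    obtain ⟨j, hj⟩ := hne ψ h0
    exact hj (congrFun hψ j)
  have hrange : dualCode (bchCode F β (Fintype.card F + 1) 3 h) = LinearMap.range T := by
    ext v
    rw [mem_dualCode_bchCode_iff hβ.pow_eq_one, LinearMap.mem_range]
    exact exists_congr fun ψ => eq_comm
  rw [hrange, LinearMap.finrank_range_of_inj hT, Subspace.dual_finrank_eq, Module.finrank_prod,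
    hL]

end Main

end CodingTheory

theorem mainTheorem1 (p s i m q h : ℕ) (hp : p.Prime) (hs : 1 < s) (hi : 0 < i) (his : i < s)
    (hm : m = Nat.gcd i s) (hq : q = p ^ s) (hh : h = (q - p ^ i) / 2)
    (F : Type*) [Field F] [Fintype F] [DecidableEq F] (hF : Fintype.card F = q)
    (L : Type*) [Field L] [Algebra F L] (hL : Module.finrank F L = 2)
    (β : L) (hβ : IsPrimitiveRoot β (q + 1)) :
    CodingTheory.IsWeightCode 4 (CodingTheory.dualCode (CodingTheory.bchCode F β (q + 1) 3 h)) ∧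
    CodingTheory.HasParameters (CodingTheory.dualCode (CodingTheory.bchCode F β (q + 1) 3 h))
      4 (q - p ^ m) := by
  subst hF
  have : Fact p.Prime := ⟨hp⟩
  have : CharP F p := charP_of_card_eq_prime_pow hq
  have : CharP L p := charP_of_injective_algebraMap' F p
  have : ExpChar F p := .prime hp
  have : ExpChar L p := .prime hp
  have : FiniteDimensional F L := Module.finite_of_finrank_pos (by omega)
  have hlt : p ^ i < Fintype.card F := hq ▸ Nat.pow_lt_pow_right hp.one_lt his
  -- The powers q and p^i have equal parity, so the division defining h is exact.
  have hh' : 2 * h + p ^ i = Fintype.card F := by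
    have heven : 2 ∣ Fintype.card F - p ^ i := by
      rw [hq]
      rcases hp.eq_two_or_odd' with rfl | hodd
      · exact Nat.dvd_sub (dvd_pow_self 2 (by omega)) (dvd_pow_self 2 hi.ne')
      · exact (Nat.Odd.sub_odd hodd.pow hodd.pow).two_dvd
    omega
  have hm0 : m ≠ 0 := by rw [hm]; exact (Nat.gcd_pos_of_pos_left s hi).ne'
  have hmi : m ≤ i := hm ▸ Nat.gcd_le_left s hi
  -- The bounds 1 < p^m < q keep the four weights distinct and positive.
  have hpm : 1 < p ^ m := Nat.one_lt_pow hm0 hp.one_lt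
  have hpmq : p ^ m < Fintype.card F := (Nat.pow_le_pow_right hp.pos hmi).trans_lt hlt
  have hfix := CodingTheory.card_fixed_iterateFrobenius (i := i) hp.one_lt hi hq
  rw [← hm] at hfix
  have hzeros {ψ : Module.Dual F (L × L)} (hψ : ψ ≠ 0) :=
    CodingTheory.card_zeros_mem (p := p) hL hh' hβ hψ
  have hexists (k : ℕ) := CodingTheory.exists_card_zeros_eq (p := p) (k := k) hL hh' hβ
  simp only [hfix, Finset.mem_insert, Finset.mem_singleton] at hzeros hexists
  have hdual := CodingTheory.mem_dualCode_bchCode_iff (F := F) (h := h) hβ.pow_eq_one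
  -- the weights of the nonzero words
  have hweights (w : ℕ) : (∃ c ∈ CodingTheory.dualCode
        (CodingTheory.bchCode F β (Fintype.card F + 1) 3 h), c ≠ 0 ∧ hammingNorm c = w) ↔
      w ∈ ({Fintype.card F + 1, Fintype.card F, Fintype.card F - 1, Fintype.card F - p ^ m} :
        Finset ℕ) := by
    simp only [Finset.mem_insert, Finset.mem_singleton]
    constructor
    · rintro ⟨c, hc, hc0, rfl⟩
      obtain ⟨ψ, rfl⟩ := (hdual c).1 hc
      have hψ : ψ ≠ 0 := by
        rintro rfl
        exact hc0 rfl
      have h1 := hzeros hψ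
      have h2 := CodingTheory.hammingNorm_add_card_zeros fun j : Fin (Fintype.card F + 1) =>
        ψ ((β ^ (j : ℕ)) ^ h, (β ^ (j : ℕ)) ^ (h + 1))
      omega
    · intro hw
      obtain ⟨ψ, hψ⟩ := hexists (Fintype.card F + 1 - w) (by omega)
      have h2 := CodingTheory.hammingNorm_add_card_zeros fun j : Fin (Fintype.card F + 1) =>
        ψ ((β ^ (j : ℕ)) ^ h, (β ^ (j : ℕ)) ^ (h + 1))
      refine ⟨_, (hdual _).2 ⟨ψ, rfl⟩, ?_, by omega⟩
      rw [← hammingNorm_pos_iff]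
      omega
  refine ⟨?_, ?_, (hweights _).2 (by simp), ?_⟩
  · have : {w ∈ Finset.Icc 1 (Fintype.card F + 1) | CodingTheory.weightCount
        (CodingTheory.dualCode (CodingTheory.bchCode F β (Fintype.card F + 1) 3 h)) w ≠ 0} =
        {Fintype.card F + 1, Fintype.card F, Fintype.card F - 1, Fintype.card F - p ^ m} := by
      ext w
      rw [Finset.mem_filter, CodingTheory.weightCount_ne_zero_iff, ← hweights]
      constructor
      · rintro ⟨hw, c, hc, rfl⟩
        exact ⟨c, hc, hammingNorm_pos_iff.1 (Finset.mem_Icc.1 hw).1, rfl⟩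
      · rintro ⟨c, hc, hc0, rfl⟩
        refine ⟨Finset.mem_Icc.2 ⟨hammingNorm_pos_iff.2 hc0, ?_⟩, c, hc, rfl⟩
        simpa using hammingNorm_le_card_fintype (x := c)
    rw [CodingTheory.IsWeightCode, this]
    rw [Finset.card_insert_of_notMem, Finset.card_insert_of_notMem, Finset.card_insert_of_notMem,
      Finset.card_singleton]
    all_goals
      simp only [Finset.mem_insert, Finset.mem_singleton]
      omega
  · refine CodingTheory.finrank_dualCode_bchCode hL hβ fun ψ hψ => ?_
    -- A zero word would have q + 1 zeros, which is none of the allowed counts.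
    by_contra! H
    have h1 := hzeros hψ
    simp only [H, Fintype.card_subtype_true, Fintype.card_fin] at h1
    omega
  · rintro w hw
    have := (hweights w).1 hw
    simp only [Finset.mem_insert, Finset.mem_singleton] at this
    omega
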